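/- Let $p\ge 3$ be a prime, $k$ a positive integer such that $(k,p-1):=\gcd(k,p-1)\ge 2$ and $\frac{p-1}{(k,p-1)}$ is even, $N$ an integer, and let $\rho\in\mathcal E_p=\{x\in\mathbb Q_p:\ |x|_p=1,\ |x-1|_p<p^{-1/(p-1)}\}$. Put $\theta=\rho^{2N}$ and assume $\theta\ne 1$ and $|\theta-1|_p<|k|_p$. Let $V$ be the vertex set of the semi-infinite Cayley tree $\Gamma^k_+$ of order $k$: the vertices are the finite sequences $(i_1,\dots,i_n)$ with $i_j\in\{1,\dots,k\}$, the root $x^0$ is the empty sequence, and $(i_1,\dots,i_n)$ is joined to its $k$ direct successors $(i_1,\dots,i_n,i)$. Let $W_n$ (resp. $V_n$) be the set of vertices at distance $n$ (resp. at most $n$) from $x^0$, let $L_n$ be the set of edges with both ends in $V_n$, and let $g\circ x$ denote concatenation of sequences. For $\sigma\in\{-1,1\}^{V_n}$ put $H_n(\sigma)=\sum_{\langle x,y\rangle\in L_n}N\sigma(x)\sigma(y)$. For a map $\mathbf h:V\setminus\{x^0\}\to\mathbb Q_p^{\{-1,1\}}$, $x\mapsto(h_{x,-1},h_{x,1})$,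 and $n\ge 1$ put $$\mu^{(n)}_{\mathbf h,\rho}(\sigma)=\frac{1}{Z_n}\,\rho^{H_n(\sigma)}\prod_{x\in W_n}h_{x,\sigma(x)},\qquad Z_n=\sum_{\sigma\in\{-1,1\}^{V_n}}\rho^{H_n(\sigma)}\prod_{x\in W_n}h_{x,\sigma(x)} .$$ If $Z_n\neq0$ for all $n\ge1$ and $\sum_{\omega\in\{-1,1\}^{W_{n+1}}}\mu^{(n+1)}_{\mathbf h,\rho}(\sigma\vee\omega)=\mu^{(n)}_{\mathbf h,\rho}(\sigma)$ for all $n\ge 1$ and $\sigma\in\{-1,1\}^{V_n}$, where $\sigma\vee\omega$ is the configuration on $V_{n+1}$ equal to $\sigma$ on $V_n$ and to $\omega$ on $W_{n+1}$, then the finitely additive $\mathbb Q_p$-valued probability measure $\mu_{\mathbf h,\rho}$ on the algebra of cylinder subsets of $\{-1,1\}^V$ whose marginal on $\{-1,1\}^{V_n}$ is $\mu^{(n)}_{\mathbf h,\rho}$ for every $n\ge1$ is called a generalized $p$-adic quasi Gibbs measure of the $p$-adic Ising model on $\Gamma^k_+$. For $m\ge2$ let $H_m=\{g\in V: d(g,x^0)\equiv0\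 (\mathrm{mod}\ m)\}$; the measure is called $H_m$-periodic if it is given by some $\mathbf h$ with $\mathbf h_{g\circ x}=\mathbf h_x$ for all $g\in H_m$ and $x\in V\setminus\{x^0\}$. Then there exist infinitely many periodic measures of this kind: the set of all generalized $p$-adic quasi Gibbs measures of the model that are $H_m$-periodic for some $m\ge2$ is infinite. -/

import Mathlib

/-! # The `p`-adic Ising model on the semi-infinite Cayley tree -/

namespace PadicIsing

noncomputable section

/-! ## The semi-infinite Cayley tree of order `k` -/

/-- Vertices of the semi-infinite (rooted) Cayley tree of order `k`, in coordinates: the root is the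
empty sequence and the direct successors of `(i₁, …, iₙ)` are the `k` sequences `(i₁, …, iₙ, i)`.
The distance of a vertex to the root is the length of the sequence. Concatenation `x ++ y` is the
semigroup operation `x ∘ y`. -/
abbrev Vertex (k : ℕ) : Type := List (Fin k)

/-- `y` is a direct successor of `x`. Every edge of the tree joins a vertex to exactly one of its
direct successors. -/
def IsSuccessor {k : ℕ} (x y : Vertex k) : Prop := ∃ i : Fin k, y = x ++ [i]

/-- The ball `V_n`: all vertices at distance at most `n` from the root. -/
def ball (k n : ℕ) : Finset (Vertex k) := (List.finite_length_le (Fin k) n).toFinset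

lemma mem_ball {k n : ℕ} {x : Vertex k} : x ∈ ball k n ↔ x.length ≤ n := by
  simp [ball]

/-- The translation `τ_g (x) = g ∘ x`. -/
def translate {k : ℕ} (g x : Vertex k) : Vertex k := g ++ x

/-- The sub-semigroup `G_m` of all vertices whose distance to the root is divisible by `m`. -/
def levelSubsemigroup (k m : ℕ) : Set (Vertex k) := {g | g.length ≡ 0 [MOD m]}

/-! ## Configurations (the state space `{-1, +1}` is the type `ℤˣ`) -/

/-- Configurations on the whole tree. -/
abbrev Config (k : ℕ) : Type := Vertex k → ℤˣ

/-- Configurations on `V_n`. -/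
abbrev ConfigOn (k n : ℕ) : Type := {x : Vertex k // x ∈ ball k n} → ℤˣ

/-- Restriction of a configuration to `V_n`. -/
def restrict {k : ℕ} (n : ℕ) (σ : Config k) : ConfigOn k n := fun x => σ x.1

/-- Restriction of a configuration on `V_{n+1}` to `V_n`. -/
def restrictSucc {k : ℕ} (n : ℕ) (σ : ConfigOn k (n + 1)) : ConfigOn k n :=
  fun x => σ ⟨x.1, mem_ball.2 ((mem_ball.1 x.2).trans n.le_succ)⟩

/-- The algebra of cylinder sets: the sets of configurations that depend only on the restriction
to some `V_n`. -/
def cylinderAlgebra (k : ℕ) : Set (Set (Config k)) :=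
  {A | ∃ n : ℕ, ∃ S : Set (ConfigOn k n), A = {σ | restrict n σ ∈ S}}

/-- The cylinder set `{σ | σ|_{V_n} = σₙ}`, as an element of the algebra. -/
def cylinder {k n : ℕ} (σn : ConfigOn k n) : cylinderAlgebra k :=
  ⟨{σ | restrict n σ = σn}, n, {σn}, rfl⟩

lemma isSetAlgebra_cylinderAlgebra (k : ℕ) :
    MeasureTheory.IsSetAlgebra (cylinderAlgebra k) where
  empty_mem := ⟨0, ∅, by simp⟩
  compl_mem := by
    rintro _ ⟨n, S, rfl⟩
    exact ⟨n, Sᶜ, rfl⟩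
  union_mem := by
    rintro _ _ ⟨n, S, rfl⟩ ⟨m, T, rfl⟩
    refine ⟨max n m,
      {σ | (fun x : {x // x ∈ ball k n} =>
          σ ⟨x.1, mem_ball.2 ((mem_ball.1 x.2).trans (le_max_left n m))⟩) ∈ S} ∪
        {σ | (fun x : {x // x ∈ ball k m} =>
          σ ⟨x.1, mem_ball.2 ((mem_ball.1 x.2).trans (le_max_right n m))⟩) ∈ T}, rfl⟩

/-! ## `p`-adic probability measures -/

/-- A `p`-adic probability measure on an algebra `𝓑` of subsets of `X`: a finitely additive
`ℚ_p`-valued set function with total mass one (not necessarily bounded). -/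
@[ext]
structure PadicProbabilityMeasure (p : ℕ) [Fact p.Prime] {X : Type*} (𝓑 : Set (Set X)) where
  toFun : 𝓑 → ℚ_[p]
  additive : ∀ (n : ℕ) (A : Fin n → 𝓑) (U : 𝓑),
    (∀ i j, i ≠ j → Disjoint (A i : Set X) (A j : Set X)) →
    (U : Set X) = ⋃ i, (A i : Set X) → toFun U = ∑ i, toFun (A i)
  total : ∀ U : 𝓑, (U : Set X) = Set.univ → toFun U = 1

/-! ## The model and its generalized quasi Gibbs measures -/

/-- The set `𝓔_p = {x ∈ ℚ_p : |x|_p = 1, |x - 1|_p < p^{-1/(p-1)}}`. -/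
def expSet (p : ℕ) [Fact p.Prime] : Set ℚ_[p] :=
  {x | ‖x‖ = 1 ∧ ‖x - 1‖ < (p : ℝ) ^ (-(1 / ((p : ℝ) - 1)))}

/-- The interaction function of the Ising model, `λ(u, v) = N u v`. -/
def isingInteraction (N : ℤ) (u v : ℤˣ) : ℤ := N * (u : ℤ) * (v : ℤ)

open Classical in
/-- The Hamiltonian `H_n(σ) = ∑_{⟨x,y⟩} λ(σ(x), σ(y))`, the sum over the edges with both ends in
`V_n`; each edge is listed once, directed away from the root. -/
def hamiltonian {k : ℕ} (lam : ℤˣ → ℤˣ → ℤ) (n : ℕ) (σ : ConfigOn k n) : ℤ :=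
  ∑ x : {x : Vertex k // x ∈ ball k n}, ∑ y : {y : Vertex k // y ∈ ball k n},
    if IsSuccessor x.1 y.1 then lam (σ x) (σ y) else 0

/-- A family `x ↦ h_x = (h_{x,-1}, h_{x,1}) ∈ ℚ_p^Φ`. Only its values at vertices other than the
root are ever used, so it stands for a function on `V \ {x⁰}`. -/
abbrev Field (p : ℕ) [Fact p.Prime] (k : ℕ) : Type := Vertex k → ℤˣ → ℚ_[p]

/-- The unnormalized weight `ρ^{H_n(σ)} ∏_{x ∈ W_n} h_{x,σ(x)}`, where `W_n` is the set of vertices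
at distance exactly `n` from the root. -/
def weight {p : ℕ} [Fact p.Prime] {k : ℕ} (lam : ℤˣ → ℤˣ → ℤ) (ρ : ℚ_[p]) (h : Field p k)
    (n : ℕ) (σ : ConfigOn k n) : ℚ_[p] :=
  ρ ^ hamiltonian lam n σ *
    ∏ x : {x : Vertex k // x ∈ ball k n} with x.1.length = n, h x.1 (σ x)

/-- The partition function `Z_n`. -/
def partitionFunction {p : ℕ} [Fact p.Prime] {k : ℕ} (lam : ℤˣ → ℤˣ → ℤ) (ρ : ℚ_[p])
    (h : Field p k) (n : ℕ) : ℚ_[p] :=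
  ∑ σ : ConfigOn k n, weight lam ρ h n σ

/-- The finite-volume distribution on `V_n`, evaluated at a configuration. -/
def finiteVolume {p : ℕ} [Fact p.Prime] {k : ℕ} (lam : ℤˣ → ℤˣ → ℤ) (ρ : ℚ_[p])
    (h : Field p k) (n : ℕ) (σ : ConfigOn k n) : ℚ_[p] :=
  weight lam ρ h n σ / partitionFunction lam ρ h n

/-- The compatibility condition for the finite-volume distributions on `V_n`, `n ≥ 1`. -/
def Compatible {p : ℕ} [Fact p.Prime] {k : ℕ} (lam : ℤˣ → ℤˣ → ℤ) (ρ : ℚ_[p])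
    (h : Field p k) : Prop :=
  ∀ n : ℕ, 1 ≤ n → ∀ τ : ConfigOn k n,
    ∑ σ : ConfigOn k (n + 1) with restrictSucc n σ = τ, finiteVolume lam ρ h (n + 1) σ =
      finiteVolume lam ρ h n τ

/-- `μ` is the generalized `p`-adic quasi Gibbs measure `μ_{h,ρ}` given by the family `h`: all
partition functions are nonzero, the finite-volume distributions are compatible, and they are the
marginals of `μ`. -/
def IsQuasiGibbs {p : ℕ} [Fact p.Prime] {k : ℕ} (lam : ℤˣ → ℤˣ → ℤ) (ρ : ℚ_[p])
    (h : Field p k) (μ : PadicProbabilityMeasure p (cylinderAlgebra k)) : Prop :=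
  (∀ n : ℕ, 1 ≤ n → partitionFunction lam ρ h n ≠ 0) ∧
  Compatible lam ρ h ∧
  ∀ n : ℕ, 1 ≤ n → ∀ σ : ConfigOn k n, μ.toFun (cylinder σ) = finiteVolume lam ρ h n σ

/-- The family `h` (on the vertices other than the root) is `G`-periodic. -/
def IsPeriodicField {p : ℕ} [Fact p.Prime] {k : ℕ} (G : Set (Vertex k)) (h : Field p k) : Prop :=
  ∀ g ∈ G, ∀ x : Vertex k, x ≠ [] → h (translate g x) = h x

/-- `μ` is a `G`-periodic generalized `p`-adic quasi Gibbs measure: it is given by some `G`-periodic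
family. -/
def IsPeriodicQuasiGibbs {p : ℕ} [Fact p.Prime] {k : ℕ} (lam : ℤˣ → ℤˣ → ℤ) (ρ : ℚ_[p])
    (G : Set (Vertex k)) (μ : PadicProbabilityMeasure p (cylinderAlgebra k)) : Prop :=
  ∃ h : Field p k, IsPeriodicField G h ∧ IsQuasiGibbs lam ρ h μ

end

end PadicIsing

namespace PadicIsing

section PadicPowers

variable {p : ℕ} [Fact p.Prime]

lemma toZMod_eq_zero_iff_dvd (x : ℤ_[p]) : PadicInt.toZMod x = 0 ↔ (p : ℤ_[p]) ∣ x := by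
  rw [← RingHom.mem_ker, PadicInt.ker_toZMod, PadicInt.maximalIdeal_eq_span_p,
    Ideal.mem_span_singleton]

lemma isUnit_iff_toZMod_ne_zero (x : ℤ_[p]) : IsUnit x ↔ PadicInt.toZMod x ≠ 0 := by
  rw [Ne, ← RingHom.mem_ker, PadicInt.ker_toZMod, IsLocalRing.mem_maximalIdeal, mem_nonunits_iff,
    not_not]

lemma natCast_p_ne_zero : (p : ℤ_[p]) ≠ 0 := by
  exact_mod_cast (Fact.out : p.Prime).ne_zero

/-- On `1 + p ℤ_p` the difference of two `k`-th powers is `k` times the difference of the bases,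
up to a factor in `1 + p ℤ_p`. -/
lemma exists_pow_sub_pow_eq (hp : 3 ≤ p) (k : ℕ) : ∀ s t : ℤ_[p], PadicInt.toZMod s = 1 →
    PadicInt.toZMod t = 1 → ∃ c : ℤ_[p], s ^ k - t ^ k = k * (s - t) * (1 + p * c) := by
  have hpr : p.Prime := Fact.out
  induction k using Nat.recOnMul with
  | zero => intro s t _ _; exact ⟨0, by simp⟩
  | one => intro s t _ _; exact ⟨0, by simp⟩
  | prime q hq =>
    intro s t hs ht
    have hgeom := geom_sum₂_mul s t q
    by_cases hqp : q = p
    · subst hqp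
      obtain ⟨b, hb⟩ : (q : ℤ_[q]) ∣ s - t := by
        rw [← toZMod_eq_zero_iff_dvd]; simp [hs, ht]
      obtain ⟨d, hd⟩ := odd_sq_dvd_geom_sum₂_sub t b (hpr.odd_of_ne_two (by omega))
      obtain ⟨a, ha⟩ : (q : ℤ_[q]) ∣ t ^ (q - 1) - 1 := by
        rw [← toZMod_eq_zero_iff_dvd]; simp [ht]
      have hs' : t + q * b = s := by rw [← hb]; ring
      rw [hs'] at hd
      refine ⟨a + d, ?_⟩
      rw [← hgeom, sub_eq_iff_eq_add.1 hd, sub_eq_iff_eq_add.1 ha]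
      ring
    · have hu : IsUnit (q : ℤ_[p]) := by
        rw [isUnit_iff_toZMod_ne_zero, map_natCast, Ne, ZMod.natCast_eq_zero_iff]
        exact fun h => hqp ((Nat.prime_dvd_prime_iff_eq hpr hq).1 h).symm
      obtain ⟨v, hv⟩ := hu.exists_right_inv
      obtain ⟨a, ha⟩ : (p : ℤ_[p]) ∣
          (∑ i ∈ Finset.range q, s ^ i * t ^ (q - 1 - i)) - q := by
        rw [← toZMod_eq_zero_iff_dvd]; simp [hs, ht]
      refine ⟨v * a, ?_⟩
      rw [← hgeom, sub_eq_iff_eq_add.1 ha]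
      linear_combination (-p * a * (s - t)) * hv
  | mul a b iha ihb =>
    intro s t hs ht
    obtain ⟨c, hc⟩ := iha s t hs ht
    obtain ⟨d, hd⟩ := ihb (s ^ a) (t ^ a) (by simp [hs]) (by simp [ht])
    refine ⟨c + d + p * c * d, ?_⟩
    rw [pow_mul, pow_mul, hd, hc]
    push_cast
    ring

/-- `k`-th roots of elements close to `1`. -/
lemma exists_pow_eq_one_add (hp : 3 ≤ p) {k : ℕ} (hk : k ≠ 0) (u : ℤ_[p]) :
    ∃ s : ℤ_[p], PadicInt.toZMod s = 1 ∧ s ^ k = 1 + k * p * u := by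
  have hk0 : (k : ℤ_[p]) ≠ 0 := by exact_mod_cast hk
  have hp0 : (p : ℤ_[p]) ≠ 0 := natCast_p_ne_zero
  have h1 : ∀ w : ℤ_[p], PadicInt.toZMod (1 + (p : ℤ_[p]) * w) = 1 := fun w => by simp
  have hex : ∀ w : ℤ_[p], ∃ q : ℤ_[p], (1 + (p : ℤ_[p]) * w) ^ k = 1 + k * p * q := by
    intro w
    obtain ⟨c, hc⟩ := exists_pow_sub_pow_eq hp k (1 + p * w) 1 (h1 w) (map_one _)
    refine ⟨w * (1 + p * c), ?_⟩
    rw [one_pow] at hc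
    linear_combination hc
  choose q hq using hex
  have hT : ContractingWith (p : NNReal)⁻¹ (fun w => w - q w + u) := by
    constructor
    · exact inv_lt_one_of_one_lt₀ (by exact_mod_cast (by omega : 1 < p))
    · refine LipschitzWith.of_dist_le_mul fun w w' => ?_
      obtain ⟨c, hc⟩ := exists_pow_sub_pow_eq hp k (1 + p * w) (1 + p * w') (h1 w) (h1 w')
      have hqq : q w - q w' = (w - w') * (1 + p * c) := by
        have : (k : ℤ_[p]) * p * (q w - q w') = k * p * ((w - w') * (1 + p * c)) := by
          linear_combination hc - hq w + hq w'
        exact mul_left_cancel₀ (mul_ne_zero hk0 hp0) this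
      have : w - q w + u - (w' - q w' + u) = -(p * c * (w - w')) := by
        linear_combination -hqq
      rw [dist_eq_norm, dist_eq_norm, this, norm_neg, norm_mul, norm_mul, PadicInt.norm_p]
      push_cast
      gcongr
      exact mul_le_of_le_one_right (by positivity) (PadicInt.norm_le_one c)
  have hfix := hT.fixedPoint_isFixedPt
  set w := ContractingWith.fixedPoint _ hT
  have hw : q w = u := by
    have : w - q w + u = w := hfix
    linear_combination -this
  exact ⟨1 + p * w, h1 w, by rw [hq, hw]⟩

lemma eq_one_of_pow_sub_one_eq_one (hp : 3 ≤ p) {s : ℤ_[p]} (hs : PadicInt.toZMod s = 1)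
    (h : s ^ (p - 1) = 1) : s = 1 := by
  obtain ⟨c, hc⟩ := exists_pow_sub_pow_eq hp (p - 1) s 1 hs (map_one _)
  rw [h, one_pow, sub_self] at hc
  have hc1 : (1 + p * c : ℤ_[p]) ≠ 0 := by
    intro h0
    have := congrArg PadicInt.toZMod h0
    simp at this
  have hp1 : ((p - 1 : ℕ) : ℤ_[p]) ≠ 0 := by
    exact_mod_cast (by omega : p - 1 ≠ 0)
  have := mul_eq_zero.1 (mul_eq_zero.1 hc.symm |>.resolve_right hc1) |>.resolve_left hp1
  exact sub_eq_zero.1 this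

/-- Teichmüller representatives. -/
lemma exists_toZMod_eq_pow_sub_one_eq_one (hp : 3 ≤ p) {a : ZMod p} (ha : a ≠ 0) :
    ∃ y : ℤ_[p], PadicInt.toZMod y = a ∧ y ^ (p - 1) = 1 := by
  have hlift : PadicInt.toZMod ((a.val : ℕ) : ℤ_[p]) = a := by simp
  have hpow : PadicInt.toZMod (((a.val : ℕ) : ℤ_[p]) ^ (p - 1)) = 1 := by
    rw [map_pow, hlift, ZMod.pow_card_sub_one_eq_one ha]
  obtain ⟨v, hv⟩ := ((isUnit_iff_toZMod_ne_zero _).2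
    (by rw [hpow]; exact one_ne_zero)).exists_right_inv
  have hv1 : PadicInt.toZMod v = 1 := by
    have := congrArg PadicInt.toZMod hv
    rwa [map_mul, hpow, one_mul, map_one] at this
  obtain ⟨d, hd⟩ : (p : ℤ_[p]) ∣ v - 1 := by
    rw [← toZMod_eq_zero_iff_dvd]; simp [hv1]
  have hunit : IsUnit ((p - 1 : ℕ) : ℤ_[p]) := by
    rw [isUnit_iff_toZMod_ne_zero, map_natCast, Nat.cast_sub (by omega)]
    simp
  obtain ⟨r, hr⟩ := hunit.exists_right_inv
  obtain ⟨s, hs, hsp⟩ := exists_pow_eq_one_add hp (by omega : p - 1 ≠ 0) (r * d)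
  refine ⟨(a.val : ℕ) * s, by rw [map_mul, hlift, hs, mul_one], ?_⟩
  rw [mul_pow, hsp]
  linear_combination hv + ((a.val : ℕ) : ℤ_[p]) ^ (p - 1) * (p * d * hr - hd)

lemma exists_zmod_pow_eq_neg_one (hp : 3 ≤ p) {k : ℕ}
    (heven : Even ((p - 1) / Nat.gcd k (p - 1))) (hgcd : 2 ≤ Nat.gcd k (p - 1)) :
    ∃ a : ZMod p, a ^ k = -1 ∧ a ^ 2 ≠ 1 := by
  obtain ⟨g, hg⟩ := IsCyclic.exists_ofOrder_eq_natCard (α := (ZMod p)ˣ)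
  rw [Nat.card_eq_fintype_card, ZMod.card_units] at hg
  obtain ⟨q, hq⟩ := heven
  set d := Nat.gcd k (p - 1) with hd
  have hdp : p - 1 = d * (q + q) := by
    rw [← hq, Nat.mul_div_cancel' (Nat.gcd_dvd_right _ _)]
  obtain ⟨k', hk'⟩ : d ∣ k := Nat.gcd_dvd_left _ _
  have hq0 : 0 < q := by
    rcases Nat.eq_zero_or_pos q with h | h
    · subst h; omega
    · exact h
  have hodd : Odd k' := by
    rw [← Nat.not_even_iff_odd]
    rintro ⟨j, hj⟩
    have : d * 2 ∣ d := by
      conv_rhs => rw [hd]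
      exact Nat.dvd_gcd ⟨j, by rw [hk', hj]; ring⟩ ⟨q, by rw [hdp]; ring⟩
    have := Nat.le_of_dvd (by omega) this
    omega
  have hhalf : ((g : ZMod p)) ^ (d * q) = -1 := by
    have hsq : ((g : ZMod p) ^ (d * q)) ^ 2 = 1 := by
      rw [← pow_mul]
      have := pow_orderOf_eq_one g
      rw [hg, hdp] at this
      have h2 := congrArg (Units.val) this
      rw [Units.val_pow_eq_pow_val, Units.val_one] at h2
      rw [← h2]; congr 1; ring
    refine (sq_eq_sq_iff_eq_or_eq_neg.1 (hsq.trans (one_pow 2).symm)).resolve_left fun h => ?_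
    have h' : g ^ (d * q) = 1 := Units.ext (by simpa using h)
    have := Nat.le_of_dvd (by positivity) (orderOf_dvd_of_pow_eq_one h')
    rw [hg, hdp] at this
    nlinarith
  refine ⟨(g : ZMod p) ^ q, ?_, ?_⟩
  · rw [← pow_mul, hk', show q * (d * k') = d * q * k' by ring, pow_mul, hhalf, hodd.neg_one_pow]
  · intro h
    rw [← pow_mul] at h
    have h' : g ^ (q * 2) = 1 := Units.ext (by simpa using h)
    have := Nat.le_of_dvd (by omega) (orderOf_dvd_of_pow_eq_one h')
    rw [hg, hdp] at this
    nlinarith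

/-- Two `k`-th roots of `-1` in `ℤ_p` that are distinct modulo `p`. -/
lemma exists_two_roots_of_neg_one (hp : 3 ≤ p) {k : ℕ}
    (heven : Even ((p - 1) / Nat.gcd k (p - 1))) (hgcd : 2 ≤ Nat.gcd k (p - 1)) :
    ∃ a b : ℤ_[p], a ^ k = -1 ∧ b ^ k = -1 ∧ PadicInt.toZMod a ≠ PadicInt.toZMod b := by
  obtain ⟨a₀, hak, ha2⟩ := exists_zmod_pow_eq_neg_one hp heven hgcd
  have hk0 : k ≠ 0 := by
    rintro rfl
    have : Fact (2 < p) := ⟨by omega⟩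
    rw [pow_zero] at hak
    exact ZMod.neg_one_ne_one hak.symm
  have ha0 : a₀ ≠ 0 := by
    rintro rfl
    rw [zero_pow hk0] at hak
    exact neg_ne_zero.2 one_ne_zero hak.symm
  obtain ⟨a, ha, hap⟩ := exists_toZMod_eq_pow_sub_one_eq_one hp ha0
  have hpe : Even (p - 1) :=
    ((Fact.out : p.Prime).even_sub_one (by omega))
  have hroot : a ^ k = -1 := by
    have h1 : -(a ^ k) = 1 := by
      apply eq_one_of_pow_sub_one_eq_one hp
      · rw [map_neg, map_pow, ha, hak, neg_neg]
      · rw [hpe.neg_pow, ← pow_mul, mul_comm, pow_mul, hap, one_pow]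
    rw [← h1, neg_neg]
  refine ⟨a, a ^ 3, hroot, ?_, ?_⟩
  · rw [← pow_mul, mul_comm, pow_mul, hroot]; ring
  · rw [map_pow, ha]
    intro h
    apply ha2
    have : a₀ * a₀ ^ 2 = a₀ * 1 := by linear_combination -h
    exact mul_left_cancel₀ ha0 this

end PadicPowers

section TwoBranches

variable {X : Type*} [MetricSpace X] [CompleteSpace X] [Nonempty X]

/-- Two injective contractions with disjoint ranges: for every `n` there is a periodic sequence of
period `n + 2` following the branches `φb, φa, …, φa`, and its second term determines `n`. -/
lemma exists_periodic_sequences {K : NNReal} {φa φb : X → X} (ha : ContractingWith K φa)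
    (hb : ContractingWith K φb) (hia : φa.Injective) (hib : φb.Injective)
    (hab : ∀ x y, φa x ≠ φb y) (o : X) (hoa : ∀ x, φa x = o → x = o) :
    ∃ Z : ℕ → ℕ → X, (∀ n j, Z n (j + (n + 2)) = Z n j) ∧
      (∀ n j, Z n (j + 1) = φa (Z n j) ∨ Z n (j + 1) = φb (Z n j)) ∧
      (∀ n, Z n 0 ≠ o) ∧ (Function.Injective fun n => Z n 1) := by
  have hfix : ∀ n : ℕ, ∃ x, φa^[n + 1] (φb x) = x := by
    intro n
    have hc : ContractingWith (K ^ (n + 1) * K) (φa^[n + 1] ∘ φb) := by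
      refine ⟨?_, (ha.2.iterate (n + 1)).comp hb.2⟩
      calc K ^ (n + 1) * K = K ^ (n + 2) := by ring
        _ < 1 := pow_lt_one₀ zero_le ha.1 (by omega)
    exact ⟨_, hc.fixedPoint_isFixedPt⟩
  choose x hx using hfix
  let Z : ℕ → ℕ → X := fun n j =>
    Nat.rec (x n) (fun i y => if i % (n + 2) = 0 then φb y else φa y) j
  have hZ0 : ∀ n, Z n 0 = x n := fun n => rfl
  have hZs : ∀ n j, Z n (j + 1) = if j % (n + 2) = 0 then φb (Z n j) else φa (Z n j) :=
    fun n j => rfl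
  have hZ1 : ∀ n, Z n 1 = φb (x n) := fun n => by simp [hZs, hZ0]
  have hZit : ∀ n j, j < n + 2 → Z n (j + 1) = φa^[j] (φb (x n)) := by
    intro n j
    induction j with
    | zero => intro _; simp [hZ1]
    | succ j ih =>
      intro hj
      rw [hZs, if_neg (by rw [Nat.mod_eq_of_lt hj]; omega), ih (by omega),
        Function.iterate_succ_apply']
  have hper : ∀ n j, Z n (j + (n + 2)) = Z n j := by
    intro n j
    induction j with
    | zero => rw [Nat.zero_add, hZit n (n + 1) (by omega), hx, hZ0]
    | succ j ih => rw [Nat.add_right_comm, hZs, hZs, ih, Nat.add_mod_right]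
  have hita : ∀ n y, φa^[n] y = o → y = o := by
    intro n
    induction n with
    | zero => intro y h; exact h
    | succ n ih => intro y h; exact hoa _ (ih _ h)
  have hne : ∀ n, Z n 0 ≠ o := by
    intro n h0
    rw [hZ0] at h0
    have h1 := hx n
    have h2 : φb (x n) = o := hita (n + 1) _ (h1.trans h0)
    rw [Function.iterate_succ_apply', h0, ← h2] at h1
    exact hab _ _ h1
  have hinj : ∀ n m, n < m → Z n 1 ≠ Z m 1 := by
    intro n m hnm h
    rw [hZ1, hZ1] at h
    have hxx := hib h
    obtain ⟨d, rfl⟩ := Nat.exists_eq_add_of_lt hnm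
    have h1 := hx n
    have h2 := hx (n + d + 1)
    rw [show n + d + 1 + 1 = (n + 1) + (d + 1) by ring, Function.iterate_add_apply] at h2
    rw [hxx] at h1
    have h3 := hia.iterate (n + 1) (h1.trans h2.symm)
    rw [Function.iterate_succ_apply'] at h3
    exact hab _ _ h3.symm
  refine ⟨Z, hper, fun n j => ?_, hne, fun n m h => ?_⟩
  · rw [hZs]
    split_ifs
    · exact Or.inr rfl
    · exact Or.inl rfl
  · rcases lt_trichotomy n m with hlt | rfl | hlt
    · exact absurd h (hinj _ _ hlt)
    · rfl
    · exact absurd h.symm (hinj _ _ hlt)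

end TwoBranches

section MobiusBranch

variable {p : ℕ} [Fact p.Prime]

/-- The inverse branch, near `-1`, of `z ↦ ((θ z + 1) / (z + θ)) ^ k` attached to a root `y` of
`y ^ k = -1`, in the coordinate `w` given by `z = -1 + (θ - 1) w`; here `θ = 1 + k p e`. -/
lemma exists_branch (hp : 3 ≤ p) {k : ℕ} (hk : k ≠ 0) {e : ℤ_[p]} (he : e ≠ 0) {y : ℤ_[p]}
    (hy : y ^ k = -1) :
    ∃ φ Y : ℤ_[p] → ℤ_[p], ContractingWith (p : NNReal)⁻¹ φ ∧ φ.Injective ∧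
      (∀ w, φ w = 0 → w = 0) ∧ (∀ w, Y w ^ k = -1 + k * p * e * w) ∧
      (∀ w, PadicInt.toZMod (Y w) = PadicInt.toZMod y) ∧
      ∀ w, φ w * (1 + k * p * e - Y w) = Y w + 1 := by
  have : Fact (2 < p) := ⟨by omega⟩
  have hk0 : (k : ℤ_[p]) ≠ 0 := by exact_mod_cast hk
  have hp0 : (p : ℤ_[p]) ≠ 0 := natCast_p_ne_zero
  set ε : ℤ_[p] := k * p * e with hε
  have hε0 : ε ≠ 0 := mul_ne_zero (mul_ne_zero hk0 hp0) he
  have hεp : PadicInt.toZMod ε = 0 := by simp [hε]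
  choose s hs1 hsk using fun w : ℤ_[p] => exists_pow_eq_one_add hp hk (-(e * w))
  have hYk : ∀ w, (y * s w) ^ k = -1 + ε * w := fun w => by
    rw [mul_pow, hy, hsk, hε]; ring
  have hYy : ∀ w, PadicInt.toZMod (y * s w) = PadicInt.toZMod y := fun w => by
    rw [map_mul, hs1, mul_one]
  have hy1 : PadicInt.toZMod y ≠ 1 := by
    intro h
    have := congrArg PadicInt.toZMod hy
    rw [map_pow, h, one_pow, map_neg, map_one] at this
    exact ZMod.neg_one_ne_one this.symm
  have hunit : ∀ w, IsUnit (1 + ε - y * s w) := fun w => by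
    rw [isUnit_iff_toZMod_ne_zero, map_sub, map_add, hεp, map_one, hYy, add_zero]
    exact sub_ne_zero.2 hy1.symm
  choose v hv using fun w => (hunit w).exists_right_inv
  have hθ2 : ε + 2 ≠ 0 := by
    intro h
    have := congrArg PadicInt.toZMod h
    rw [map_add, hεp, zero_add, map_zero] at this
    have h2 : ((-1 : ZMod p)) = 1 := by
      have h3 : (2 : ZMod p) = 0 := by rwa [map_ofNat] at this
      linear_combination -h3
    exact ZMod.neg_one_ne_one h2
  have hφ : ∀ w, ((y * s w + 1) * v w) * (1 + ε - y * s w) = y * s w + 1 := fun w => by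
    linear_combination (y * s w + 1) * hv w
  refine ⟨fun w => (y * s w + 1) * v w, fun w => y * s w, ?_, ?_, ?_, hYk, hYy, hφ⟩
  · refine ⟨inv_lt_one_of_one_lt₀ (by exact_mod_cast (by omega : 1 < p)), ?_⟩
    refine LipschitzWith.of_dist_le_mul fun w w' => ?_
    obtain ⟨c, hc⟩ := exists_pow_sub_pow_eq hp k (s w) (s w') (hs1 w) (hs1 w')
    have hcu : IsUnit (1 + p * c : ℤ_[p]) := by
      rw [isUnit_iff_toZMod_ne_zero]; simp
    obtain ⟨r, hr⟩ := hcu.exists_right_inv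
    have hss : s w - s w' = p * (e * r * (w' - w)) := by
      have h1 : (k : ℤ_[p]) * ((s w - s w') * (1 + p * c)) = k * (p * (e * (w' - w))) := by
        linear_combination -hc + hsk w - hsk w'
      have h2 := mul_left_cancel₀ hk0 h1
      linear_combination r * h2 - (s w - s w') * hr
    have hdiff : (y * s w + 1) * v w - (y * s w' + 1) * v w' =
        p * ((v w * v w' * y * (ε + 2) * e * r) * (w' - w)) := by
      have : (y * s w + 1) * v w - (y * s w' + 1) * v w' =
          v w * v w' * y * (ε + 2) * (s w - s w') := by
        linear_combination (y * s w' + 1) * v w' * hv w - (y * s w + 1) * v w * hv w'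
      rw [this, hss]; ring
    rw [dist_eq_norm, dist_eq_norm, hdiff, norm_mul, norm_mul, PadicInt.norm_p, norm_sub_rev w' w]
    push_cast
    gcongr
    exact mul_le_of_le_one_left (norm_nonneg _) (PadicInt.norm_le_one _)
  · intro w w' h
    have hφw := hφ w
    have hφw' := hφ w'
    have h' : (y * s w + 1) * v w = (y * s w' + 1) * v w' := h
    rw [← h'] at hφw'
    set f := (y * s w + 1) * v w
    have hf : f + 1 ≠ 0 := by
      intro h0
      apply hθ2
      linear_combination (1 + ε - y * s w) * h0 - hφw
    have hY : y * s w = y * s w' := by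
      have : (f + 1) * (y * s w) = (f + 1) * (y * s w') := by
        linear_combination hφw' - hφw
      exact mul_left_cancel₀ hf this
    have := hYk w
    rw [hY, hYk w'] at this
    exact (mul_left_cancel₀ hε0 (add_left_cancel this)).symm
  · intro w h
    have hφw := hφ w
    have h' : (y * s w + 1) * v w = 0 := h
    rw [h', zero_mul] at hφw
    have hY : y * s w = -1 := by linear_combination -hφw
    have hk1 := hYk w
    rw [hY] at hk1
    rcases Nat.even_or_odd k with hev | hod
    · exfalso
      rw [hev.neg_one_pow] at hk1
      have := congrArg PadicInt.toZMod hk1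
      rw [map_add, map_mul, hεp, zero_mul, add_zero, map_neg, map_one] at this
      exact ZMod.neg_one_ne_one this.symm
    · rw [hod.neg_one_pow] at hk1
      have : ε * w = 0 := by linear_combination -hk1
      exact (mul_eq_zero.1 this).resolve_left hε0

end MobiusBranch

end PadicIsing

namespace PadicIsing

noncomputable section

section Tree

variable {k : ℕ}

/-- The sphere `W_n`: all vertices at distance exactly `n` from the root. -/
def level (k n : ℕ) : Finset (Vertex k) := (List.finite_length_eq (Fin k) n).toFinset

lemma mem_level {n : ℕ} {x : Vertex k} : x ∈ level k n ↔ x.length = n := by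
  simp [level]

lemma level_zero : level k 0 = {[]} := by
  ext x; simp [mem_level]

lemma level_succ (n : ℕ) :
    level k (n + 1) = (level k n ×ˢ (Finset.univ : Finset (Fin k))).image
      fun q => q.1 ++ [q.2] := by
  ext x
  simp only [mem_level, Finset.mem_image, Finset.mem_product, Finset.mem_univ, and_true,
    Prod.exists]
  constructor
  · intro hx
    have hne : x ≠ [] := by rintro rfl; simp at hx
    exact ⟨x.dropLast, x.getLast hne, by simp [hx], List.dropLast_append_getLast hne⟩
  · rintro ⟨y, i, hy, rfl⟩
    simp [hy]

lemma successor_injective :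
    Function.Injective fun q : Vertex k × Fin k => q.1 ++ [q.2] := by
  rintro ⟨x, i⟩ ⟨y, j⟩ h
  obtain ⟨h1, h2⟩ := List.append_inj' h rfl
  simp only [List.cons.injEq, and_true] at h2
  exact Prod.ext h1 h2

@[to_additive]
lemma prod_level_succ {M : Type*} [CommMonoid M] (n : ℕ) (f : Vertex k → M) :
    ∏ y ∈ level k (n + 1), f y = ∏ x ∈ level k n, ∏ i : Fin k, f (x ++ [i]) := by
  rw [level_succ, Finset.prod_image successor_injective.injOn, Finset.prod_product]

/-- The interaction energy, inside `V_n`, of a configuration on the whole tree. -/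
def energy (lam : ℤˣ → ℤˣ → ℤ) (n : ℕ) (σ : Config k) : ℤ :=
  ∑ j ∈ Finset.range n, ∑ x ∈ level k j, ∑ i : Fin k, lam (σ x) (σ (x ++ [i]))

lemma energy_congr (lam : ℤˣ → ℤˣ → ℤ) (n : ℕ) {σ τ : Config k}
    (h : ∀ x, x.length ≤ n → σ x = τ x) : energy lam n σ = energy lam n τ := by
  refine Finset.sum_congr rfl fun j hj => Finset.sum_congr rfl fun x hx =>
    Finset.sum_congr rfl fun i _ => ?_
  rw [Finset.mem_range] at hj
  rw [mem_level] at hx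
  rw [h x (by omega), h (x ++ [i]) (by simp; omega)]

lemma hamiltonian_restrict (lam : ℤˣ → ℤˣ → ℤ) (n : ℕ) (σ : Config k) :
    hamiltonian lam n (restrict n σ) = energy lam n σ := by
  classical
  have h1 : hamiltonian lam n (restrict n σ) =
      ∑ x ∈ ball k n, ∑ y ∈ ball k n, if IsSuccessor x y then lam (σ x) (σ y) else 0 := by
    rw [← Finset.sum_coe_sort (ball k n)]
    refine Finset.sum_congr rfl fun x _ => ?_
    rw [← Finset.sum_coe_sort (ball k n)]
    refine Finset.sum_congr rfl fun y _ => ?_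
    simp only [restrict]
  have hin : ∀ x : Vertex k, ∑ y ∈ ball k n, (if IsSuccessor x y then lam (σ x) (σ y) else 0) =
      if x.length < n then ∑ i : Fin k, lam (σ x) (σ (x ++ [i])) else 0 := by
    intro x
    split_ifs with hx
    · rw [← Finset.sum_filter]
      have hinj : Function.Injective fun i : Fin k => x ++ [i] := fun i j h => by simpa using h
      rw [← Finset.sum_image (f := fun y => lam (σ x) (σ y)) hinj.injOn]
      refine Finset.sum_congr ?_ fun _ _ => rfl
      ext y
      rw [Finset.mem_filter, mem_ball, Finset.mem_image]
      simp only [Finset.mem_univ, true_and]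
      constructor
      · rintro ⟨_, i, rfl⟩
        exact ⟨i, rfl⟩
      · rintro ⟨i, rfl⟩
        exact ⟨by rw [List.length_append, List.length_singleton]; omega, i, rfl⟩
    · refine Finset.sum_eq_zero fun y hy => if_neg ?_
      rintro ⟨i, rfl⟩
      rw [mem_ball, List.length_append, List.length_singleton] at hy
      omega
  rw [h1, Finset.sum_congr rfl fun x _ => hin x, ← Finset.sum_filter,
    ← Finset.sum_fiberwise_of_maps_to (t := Finset.range n) (g := List.length)
      (fun x hx => Finset.mem_range.2 (Finset.mem_filter.1 hx).2)]
  refine Finset.sum_congr rfl fun j hj => Finset.sum_congr ?_ fun _ _ => rfl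
  ext x
  rw [Finset.mem_range] at hj
  simp only [Finset.mem_filter, mem_ball, mem_level]
  omega

/-- Extend a configuration on `V_n` by `1`. -/
def extend {n : ℕ} (τ : ConfigOn k n) : Config k :=
  fun x => if h : x ∈ ball k n then τ ⟨x, h⟩ else 1

lemma restrict_extend {n : ℕ} (τ : ConfigOn k n) : restrict n (extend τ) = τ := by
  funext x
  simp [restrict, extend, x.2]

lemma restrict_extend_succ {n : ℕ} (σ : ConfigOn k (n + 1)) :
    restrict n (extend σ) = restrictSucc n σ := by
  rw [← congrArg (restrictSucc n) (restrict_extend σ)]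
  rfl

/-- Replace the values of a configuration on `W_n`. -/
def glue (n : ℕ) (σ : Config k) (ω : {x // x ∈ level k n} → ℤˣ) : Config k :=
  fun x => if h : x ∈ level k n then ω ⟨x, h⟩ else σ x

lemma glue_of_mem {n : ℕ} (σ : Config k) (ω : {x // x ∈ level k n} → ℤˣ)
    (x : {x // x ∈ level k n}) : glue n σ ω x = ω x := by
  simp [glue, x.2]

lemma glue_of_length_le {n : ℕ} (σ : Config k) (ω : {x // x ∈ level k (n + 1)} → ℤˣ)
    {x : Vertex k} (hx : x.length ≤ n) : glue (n + 1) σ ω x = σ x := by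
  rw [glue, dif_neg]
  rw [mem_level]
  omega

lemma sum_restrictSucc_eq {M : Type*} [AddCommMonoid M] (n : ℕ) (τ : Config k)
    (F : ConfigOn k (n + 1) → M) :
    ∑ σ : ConfigOn k (n + 1) with restrictSucc n σ = restrict n τ, F σ =
      ∑ ω : {x // x ∈ level k (n + 1)} → ℤˣ, F (restrict (n + 1) (glue (n + 1) τ ω)) := by
  symm
  refine Finset.sum_bij' (fun ω _ => restrict (n + 1) (glue (n + 1) τ ω))
    (fun σ _ y => σ ⟨y.1, mem_ball.2 (mem_level.1 y.2).le⟩) ?_ ?_ ?_ ?_ ?_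
  · intro ω _
    rw [Finset.mem_filter]
    refine ⟨Finset.mem_univ _, ?_⟩
    funext x
    exact glue_of_length_le τ ω (mem_ball.1 x.2)
  · intro σ _
    exact Finset.mem_univ _
  · intro ω _
    funext y
    exact glue_of_mem τ ω y
  · intro σ hσ
    rw [Finset.mem_filter] at hσ
    funext x
    by_cases hx : x.1 ∈ level k (n + 1)
    · simp [restrict, glue, hx]
    · have hxn : x.1.length ≤ n := by
        have := mem_ball.1 x.2
        rw [mem_level] at hx
        omega
      have := congrFun hσ.2 ⟨x.1, mem_ball.2 hxn⟩
      simp only [restrictSucc, restrict] at this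
      simp [restrict, glue, hx, this]
  · intro ω _
    rfl

end Tree

section Weights

variable {p : ℕ} [Fact p.Prime] {k : ℕ}

lemma weight_restrict (lam : ℤˣ → ℤˣ → ℤ) (ρ : ℚ_[p]) (h : Field p k) (n : ℕ) (σ : Config k) :
    weight lam ρ h n (restrict n σ) =
      ρ ^ energy lam n σ * ∏ x ∈ level k n, h x (σ x) := by
  rw [weight, hamiltonian_restrict]
  congr 1
  simp only [restrict]
  rw [Finset.prod_filter, Finset.prod_coe_sort (ball k n)
    (fun x => if x.length = n then h x (σ x) else 1), ← Finset.prod_filter]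
  refine Finset.prod_congr ?_ fun _ _ => rfl
  ext x
  simp only [Finset.mem_filter, mem_ball, mem_level]
  omega

lemma zpow_sum {ι : Type*} {ρ : ℚ_[p]} (hρ : ρ ≠ 0) (s : Finset ι) (f : ι → ℤ) :
    ρ ^ (∑ i ∈ s, f i) = ∏ i ∈ s, ρ ^ f i := by
  classical
  induction s using Finset.induction_on with
  | empty => simp
  | insert a s ha ih => rw [Finset.sum_insert ha, Finset.prod_insert ha, zpow_add₀ hρ, ih]

/-- Summation of the weights over the spins on `W_{n+1}`. -/
lemma sum_weight_succ (lam : ℤˣ → ℤˣ → ℤ) {ρ : ℚ_[p]} (hρ : ρ ≠ 0) (h : Field p k) (n : ℕ)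
    (τ : Config k) :
    ∑ σ : ConfigOn k (n + 1) with restrictSucc n σ = restrict n τ, weight lam ρ h (n + 1) σ =
      ρ ^ energy lam n τ * ∏ x ∈ level k n, ∏ i : Fin k,
        ∑ s : ℤˣ, ρ ^ lam (τ x) s * h (x ++ [i]) s := by
  rw [sum_restrictSucc_eq]
  have hterm : ∀ ω : {x // x ∈ level k (n + 1)} → ℤˣ,
      weight lam ρ h (n + 1) (restrict (n + 1) (glue (n + 1) τ ω)) =
        ρ ^ energy lam n τ * ∏ y : {x // x ∈ level k (n + 1)},
          (ρ ^ lam (τ y.1.dropLast) (ω y) * h y.1 (ω y)) := by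
    intro ω
    have hE : energy lam (n + 1) (glue (n + 1) τ ω) =
        energy lam n τ + ∑ y : {x // x ∈ level k (n + 1)}, lam (τ y.1.dropLast) (ω y) := by
      rw [energy, Finset.sum_range_succ]
      congr 1
      · exact energy_congr lam n fun x hx => glue_of_length_le τ ω hx
      · simp only [← glue_of_mem τ ω]
        rw [Finset.sum_coe_sort (level k (n + 1))
            (fun y => lam (τ y.dropLast) (glue (n + 1) τ ω y)), sum_level_succ]
        refine Finset.sum_congr rfl fun x hx => Finset.sum_congr rfl fun i _ => ?_
        rw [List.dropLast_concat, glue_of_length_le τ ω (mem_level.1 hx).le]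
    rw [weight_restrict, hE, zpow_add₀ hρ, zpow_sum hρ, mul_assoc, Finset.prod_mul_distrib]
    congr 2
    rw [← Finset.prod_coe_sort (level k (n + 1))]
    exact Finset.prod_congr rfl fun y _ => by rw [glue_of_mem]
  rw [Finset.sum_congr rfl fun ω _ => hterm ω, ← Finset.mul_sum,
    ← Fintype.prod_sum (fun (y : {x // x ∈ level k (n + 1)}) (s : ℤˣ) =>
      ρ ^ lam (τ y.1.dropLast) s * h y.1 s),
    Finset.prod_coe_sort (level k (n + 1))
      (fun y => ∑ s : ℤˣ, ρ ^ lam (τ y.dropLast) s * h y s), prod_level_succ]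
  simp only [List.dropLast_concat]

/-- The recursion that makes the finite-volume distributions compatible. -/
def SatisfiesRecursion (lam : ℤˣ → ℤˣ → ℤ) (ρ : ℚ_[p]) (h : Field p k) (A : ℕ → ℚ_[p]) : Prop :=
  ∀ x u, ∏ i : Fin k, ∑ s : ℤˣ, ρ ^ lam u s * h (x ++ [i]) s = A x.length * h x u

variable {lam : ℤˣ → ℤˣ → ℤ} {ρ : ℚ_[p]} {h : Field p k} {A : ℕ → ℚ_[p]}

lemma SatisfiesRecursion.sum_weight (hrec : SatisfiesRecursion lam ρ h A) (hρ : ρ ≠ 0) (n : ℕ)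
    (τ : ConfigOn k n) :
    ∑ σ : ConfigOn k (n + 1) with restrictSucc n σ = τ, weight lam ρ h (n + 1) σ =
      A n ^ (level k n).card * weight lam ρ h n τ := by
  rw [← restrict_extend τ, sum_weight_succ lam hρ, weight_restrict]
  rw [Finset.prod_congr rfl fun x hx => by rw [hrec x, mem_level.1 hx],
    Finset.prod_mul_distrib, Finset.prod_const]
  ring

lemma SatisfiesRecursion.partitionFunction_succ (hrec : SatisfiesRecursion lam ρ h A) (hρ : ρ ≠ 0)
    (n : ℕ) :
    partitionFunction lam ρ h (n + 1) =
      A n ^ (level k n).card * partitionFunction lam ρ h n := by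
  rw [partitionFunction, partitionFunction, Finset.mul_sum,
    ← Finset.sum_fiberwise (g := restrictSucc n)]
  exact Finset.sum_congr rfl fun τ _ => hrec.sum_weight hρ n τ

lemma SatisfiesRecursion.partitionFunction_ne_zero (hrec : SatisfiesRecursion lam ρ h A)
    (hρ : ρ ≠ 0) (hA : ∀ n, A n ≠ 0) (h0 : partitionFunction lam ρ h 0 ≠ 0) (n : ℕ) :
    partitionFunction lam ρ h n ≠ 0 := by
  induction n with
  | zero => exact h0
  | succ n ih =>
    rw [hrec.partitionFunction_succ hρ]
    exact mul_ne_zero (pow_ne_zero _ (hA n)) ih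

lemma SatisfiesRecursion.sum_finiteVolume (hrec : SatisfiesRecursion lam ρ h A)
    (hρ : ρ ≠ 0) (hA : ∀ n, A n ≠ 0) (n : ℕ) (τ : ConfigOn k n) :
    ∑ σ : ConfigOn k (n + 1) with restrictSucc n σ = τ, finiteVolume lam ρ h (n + 1) σ =
      finiteVolume lam ρ h n τ := by
  simp only [finiteVolume]
  rw [← Finset.sum_div, hrec.sum_weight hρ, hrec.partitionFunction_succ hρ,
    mul_div_mul_left _ _ (pow_ne_zero _ (hA n))]

end Weights

end

end PadicIsing

namespace PadicIsing

noncomputable section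

section Extension

variable {p : ℕ} [Fact p.Prime] {k : ℕ}

/-- The cylinder sets based on `V_n`. -/
def DependsOnBall (n : ℕ) (B : Set (Config k)) : Prop :=
  ∃ S : Set (ConfigOn k n), B = {σ | restrict n σ ∈ S}

lemma DependsOnBall.mem_iff {n : ℕ} {B : Set (Config k)} (hB : DependsOnBall n B) {σ τ : Config k}
    (h : restrict n σ = restrict n τ) : σ ∈ B ↔ τ ∈ B := by
  obtain ⟨S, rfl⟩ := hB
  simp only [Set.mem_ofPred_eq, h]

lemma DependsOnBall.mono {n m : ℕ} (hnm : n ≤ m) {B : Set (Config k)} (hB : DependsOnBall n B) :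
    DependsOnBall m B := by
  obtain ⟨S, rfl⟩ := hB
  exact ⟨{σ | (fun x : {x // x ∈ ball k n} =>
    σ ⟨x.1, mem_ball.2 ((mem_ball.1 x.2).trans hnm)⟩) ∈ S}, rfl⟩

open Classical in
/-- The mass that a distribution on `V_n` gives to a set of configurations. -/
def mass (ν : ∀ n, ConfigOn k n → ℚ_[p]) (n : ℕ) (B : Set (Config k)) : ℚ_[p] :=
  ∑ σ : ConfigOn k n, if extend σ ∈ B then ν n σ else 0

/-- Compatibility of a family of distributions on the balls. -/
def IsProjective (ν : ∀ n, ConfigOn k n → ℚ_[p]) : Prop :=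
  ∀ n τ, ∑ σ : ConfigOn k (n + 1) with restrictSucc n σ = τ, ν (n + 1) σ = ν n τ

variable {ν : ∀ n, ConfigOn k n → ℚ_[p]}

lemma IsProjective.mass_succ (hν : IsProjective ν) {n : ℕ} {B : Set (Config k)} (hB : DependsOnBall n B) :
    mass ν (n + 1) B = mass ν n B := by
  classical
  rw [mass, mass, ← Finset.sum_fiberwise (g := restrictSucc n)]
  refine Finset.sum_congr rfl fun τ _ => ?_
  have hmem : ∀ σ : ConfigOn k (n + 1), restrictSucc n σ = τ → (extend σ ∈ B ↔ extend τ ∈ B) :=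
    fun σ hσ => hB.mem_iff (by rw [restrict_extend_succ, restrict_extend, hσ])
  rw [Finset.sum_congr rfl fun σ hσ => by rw [if_congr (hmem σ (Finset.mem_filter.1 hσ).2) rfl rfl]]
  split_ifs
  · exact hν n τ
  · exact Finset.sum_const_zero

lemma IsProjective.mass_eq_of_le (hν : IsProjective ν) {n m : ℕ} (hnm : n ≤ m)
    {B : Set (Config k)} (hB : DependsOnBall n B) : mass ν m B = mass ν n B := by
  induction m, hnm using Nat.le_induction with
  | base => rfl
  | succ m hm ih => rw [hν.mass_succ (hB.mono hm), ih]

lemma IsProjective.mass_eq (hν : IsProjective ν) {n m : ℕ} {B : Set (Config k)}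
    (hn : DependsOnBall n B) (hm : DependsOnBall m B) : mass ν n B = mass ν m B := by
  rw [← hν.mass_eq_of_le (le_max_left n m) hn, ← hν.mass_eq_of_le (le_max_right n m) hm]

lemma mass_iUnion (n l : ℕ) (B : Fin l → Set (Config k))
    (hB : ∀ i j, i ≠ j → Disjoint (B i) (B j)) :
    mass ν n (⋃ i, B i) = ∑ i, mass ν n (B i) := by
  classical
  simp only [mass]
  rw [Finset.sum_comm]
  refine Finset.sum_congr rfl fun σ _ => ?_
  split_ifs with h
  · obtain ⟨i, hi⟩ := Set.mem_iUnion.1 h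
    rw [Finset.sum_eq_single i, if_pos hi]
    · intro j _ hji
      exact if_neg fun hj => Set.disjoint_left.1 (hB j i hji) hj hi
    · exact fun h => absurd (Finset.mem_univ i) h
  · exact (Finset.sum_eq_zero fun i _ => if_neg fun hi => h (Set.mem_iUnion.2 ⟨i, hi⟩)).symm

/-- Finitely additive extension of a projective family to the algebra of cylinder sets. -/
lemma IsProjective.exists_measure (hν : IsProjective ν) (h1 : ∑ σ, ν 0 σ = 1) :
    ∃ μ : PadicProbabilityMeasure p (cylinderAlgebra k),
      ∀ n (σ : ConfigOn k n), μ.toFun (cylinder σ) = ν n σ := by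
  classical
  have hdep : ∀ U : cylinderAlgebra k, ∃ n, DependsOnBall n (U : Set (Config k)) := fun U => U.2
  choose d hd using hdep
  refine ⟨⟨fun U => mass ν (d U) U, ?_, ?_⟩, ?_⟩
  · intro l B U hdisj hU
    obtain ⟨M, hM⟩ : ∃ M, ∀ i, d (B i) ≤ M :=
      ⟨Finset.univ.sup fun i => d (B i), fun i => Finset.le_sup (f := fun i => d (B i))
        (Finset.mem_univ i)⟩
    have hmax : ∀ i, d (B i) ≤ max M (d U) := fun i => (hM i).trans (le_max_left _ _)
    rw [← hν.mass_eq_of_le (le_max_right M (d U)) (hd U), hU, mass_iUnion _ _ _ hdisj]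
    exact Finset.sum_congr rfl fun i _ => hν.mass_eq_of_le (hmax i) (hd (B i))
  · intro U hU
    have h0 : DependsOnBall 0 (U : Set (Config k)) := ⟨Set.univ, by rw [hU]; rfl⟩
    rw [hν.mass_eq (hd U) h0, hU, mass, ← h1]
    exact Finset.sum_congr rfl fun σ _ => if_pos (Set.mem_univ _)
  · intro n σ
    have hn : DependsOnBall n (cylinder σ : Set (Config k)) := ⟨{σ}, rfl⟩
    change mass ν (d (cylinder σ)) (cylinder σ : Set (Config k)) = ν n σ
    rw [hν.mass_eq (hd (cylinder σ)) hn, mass]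
    have hmem : ∀ τ : ConfigOn k n, extend τ ∈ (cylinder σ : Set (Config k)) ↔ τ = σ := by
      intro τ
      change restrict n (extend τ) = σ ↔ τ = σ
      rw [restrict_extend]
    simp only [hmem, Finset.sum_ite_eq', Finset.mem_univ, if_true]

end Extension

section Ising

variable {p : ℕ} [Fact p.Prime] {k : ℕ}

/-- The family `h_x = (1, t_{|x|})`, which depends only on the distance to the root. -/
def levelField (k : ℕ) (t : ℕ → ℚ_[p]) : Field p k := fun x s => if s = 1 then t x.length else 1

lemma isPeriodicField_levelField {t : ℕ → ℚ_[p]} {m : ℕ} (ht : ∀ j, t (j + m) = t j) :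
    IsPeriodicField (levelSubsemigroup k m) (levelField k t) := by
  intro g hg x _
  obtain ⟨c, hc⟩ := (Nat.modEq_zero_iff_dvd).1 hg
  have hper : ∀ c, t (x.length + m * c) = t x.length := by
    intro c
    induction c with
    | zero => simp
    | succ c ih => rw [Nat.mul_succ, ← add_assoc, ht, ih]
  funext s
  simp only [levelField, translate, List.length_append]
  rw [hc, add_comm, hper]

lemma sum_units_int {M : Type*} [AddCommMonoid M] (f : ℤˣ → M) : ∑ s, f s = f 1 + f (-1) := by
  rw [UnitsInt.univ, Finset.sum_pair (by decide)]

lemma satisfiesRecursion_levelField {N : ℤ} {ρ : ℚ_[p]} (hρ : ρ ≠ 0) {t : ℕ → ℚ_[p]}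
    (hden : ∀ j, t (j + 1) + ρ ^ (2 * N) ≠ 0)
    (hrec : ∀ j, ((ρ ^ (2 * N) * t (j + 1) + 1) / (t (j + 1) + ρ ^ (2 * N))) ^ k = t j) :
    SatisfiesRecursion (isingInteraction N) ρ (levelField k t)
      fun n => (ρ ^ (-N) * (t (n + 1) + ρ ^ (2 * N))) ^ k := by
  intro x u
  have hN : ρ ^ N = ρ ^ (-N) * ρ ^ (2 * N) := by
    rw [← zpow_add₀ hρ]; congr 1; ring
  have hne : (-1 : ℤˣ) ≠ 1 := by decide
  simp only [sum_units_int, levelField, isingInteraction, List.length_append,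
    List.length_singleton, if_true, if_neg hne, Finset.prod_const, Finset.card_univ, Fintype.card_fin]
  rcases Int.units_eq_one_or u with rfl | rfl
  · rw [if_pos rfl, ← hrec x.length, ← mul_pow]
    have := hden x.length
    congr 1
    simp only [Units.val_one, Units.val_neg, mul_one, mul_neg]
    rw [hN]
    field_simp
  · rw [if_neg hne]
    simp only [Units.val_one, Units.val_neg, mul_one, mul_neg, neg_neg]
    rw [hN]
    congr 1
    ring

lemma partitionFunction_levelField_zero (lam : ℤˣ → ℤˣ → ℤ) (ρ : ℚ_[p]) (t : ℕ → ℚ_[p]) :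
    partitionFunction lam ρ (levelField k t) 0 = t 0 + 1 := by
  have hw : ∀ σ : ConfigOn k 0, weight lam ρ (levelField k t) 0 σ =
      levelField k t [] (extend σ []) := by
    intro σ
    conv_lhs => rw [← restrict_extend σ]
    rw [weight_restrict, level_zero, Finset.prod_singleton, energy, Finset.sum_range_zero,
      zpow_zero, one_mul]
  have hmem : ([] : Vertex k) ∈ ball k 0 := mem_ball.2 le_rfl
  have huniq : ∀ x : {x // x ∈ ball k 0}, x = ⟨[], hmem⟩ := fun x =>
    Subtype.ext (List.length_eq_zero_iff.1 (Nat.le_zero.1 (mem_ball.1 x.2)))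
  rw [partitionFunction, Finset.sum_congr rfl fun σ _ => hw σ]
  let E : ConfigOn k 0 ≃ ℤˣ := ⟨fun σ => σ ⟨[], hmem⟩, fun s _ => s,
    fun σ => funext fun x => by rw [huniq x], fun s => rfl⟩
  rw [Fintype.sum_equiv E _ (fun s => levelField k t [] s), sum_units_int]
  · simp [levelField, show (-1 : ℤˣ) ≠ 1 by decide]
  · intro σ
    simp [extend, hmem, E]

/-- A solution `t` of the recursion `t_j = ((θ t_{j+1} + 1) / (t_{j+1} + θ)) ^ k`, `θ = ρ ^ (2N)`,
gives a generalized quasi Gibbs measure. -/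
lemma exists_isQuasiGibbs_levelField {N : ℤ} {ρ : ℚ_[p]} (hρ : ρ ≠ 0) {t : ℕ → ℚ_[p]}
    (h0 : t 0 ≠ -1) (hden : ∀ j, t (j + 1) + ρ ^ (2 * N) ≠ 0)
    (hrec : ∀ j, ((ρ ^ (2 * N) * t (j + 1) + 1) / (t (j + 1) + ρ ^ (2 * N))) ^ k = t j) :
    ∃ μ, IsQuasiGibbs (isingInteraction N) ρ (levelField k t) μ := by
  have hR := satisfiesRecursion_levelField hρ hden hrec
  have hA : ∀ n, (ρ ^ (-N) * (t (n + 1) + ρ ^ (2 * N))) ^ k ≠ 0 := fun n =>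
    pow_ne_zero _ (mul_ne_zero (zpow_ne_zero _ hρ) (hden n))
  have hZ0 : partitionFunction (isingInteraction N) ρ (levelField k t) 0 ≠ 0 := by
    rw [partitionFunction_levelField_zero]
    exact fun h => h0 (eq_neg_of_add_eq_zero_left h)
  have hcomp : IsProjective (fun n => finiteVolume (isingInteraction N) ρ (levelField k t) n) :=
    hR.sum_finiteVolume hρ hA
  obtain ⟨μ, hμ⟩ := hcomp.exists_measure (by
    simp only [finiteVolume]
    rw [← Finset.sum_div]
    exact div_self hZ0)
  exact ⟨μ, fun n _ => hR.partitionFunction_ne_zero hρ hA hZ0 n, fun n _ => hcomp n,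
    fun n _ => hμ n⟩

/-- The measure determines the value of the level field at distance one from the root. -/
lemma IsQuasiGibbs.levelField_one_eq (hk : k ≠ 0) {lam : ℤˣ → ℤˣ → ℤ} {ρ : ℚ_[p]} (hρ : ρ ≠ 0)
    {t t' : ℕ → ℚ_[p]} {μ : PadicProbabilityMeasure p (cylinderAlgebra k)}
    (h : IsQuasiGibbs lam ρ (levelField k t) μ) (h' : IsQuasiGibbs lam ρ (levelField k t') μ) :
    t 1 = t' 1 := by
  let i : Fin k := ⟨0, Nat.pos_of_ne_zero hk⟩
  let τ : Config k := fun x => if x = [i] then 1 else -1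
  have hminus : ∀ t : ℕ → ℚ_[p], weight lam ρ (levelField k t) 1 (restrict 1 fun _ => -1) =
      ρ ^ energy lam 1 fun _ : Vertex k => (-1 : ℤˣ) := by
    intro t
    rw [weight_restrict, Finset.prod_eq_one, mul_one]
    intro x _
    exact if_neg (by decide)
  have hplus : ∀ t : ℕ → ℚ_[p], weight lam ρ (levelField k t) 1 (restrict 1 τ) =
      ρ ^ energy lam 1 τ * t 1 := by
    intro t
    rw [weight_restrict, Finset.prod_eq_single [i]]
    · simp [levelField, τ]
    · intro x _ hx
      simp only [levelField, τ, if_neg hx]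
      exact if_neg (by decide)
    · exact fun hn => absurd (mem_level.2 rfl) hn
  have e1 := (h.2.2 1 le_rfl (restrict 1 fun _ => -1)).symm.trans
    (h'.2.2 1 le_rfl (restrict 1 fun _ => -1))
  have e2 := (h.2.2 1 le_rfl (restrict 1 τ)).symm.trans (h'.2.2 1 le_rfl (restrict 1 τ))
  have hZ := h.1 1 le_rfl
  have hZ' := h'.1 1 le_rfl
  simp only [finiteVolume, hminus] at e1
  simp only [finiteVolume, hplus] at e2
  have hZZ : partitionFunction lam ρ (levelField k t) 1 =
      partitionFunction lam ρ (levelField k t') 1 := by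
    rw [div_eq_div_iff hZ hZ'] at e1
    exact (mul_left_cancel₀ (zpow_ne_zero _ hρ) e1).symm
  rw [hZZ, div_left_inj' hZ'] at e2
  exact mul_left_cancel₀ (zpow_ne_zero _ hρ) e2

end Ising

end

/-- An element of `ℚ_p` closer to `1` than `|k|` is of the form `1 + k p e` with `e ∈ ℤ_p`. -/
lemma exists_eq_one_add_mul {p : ℕ} [Fact p.Prime] {k : ℕ} (hk0 : k ≠ 0) {θ : ℚ_[p]}
    (hk : ‖θ - 1‖ < ‖(k : ℚ_[p])‖) : ∃ e : ℤ_[p], θ = 1 + k * p * e := by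
  have hkne : (k : ℚ_[p]) ≠ 0 := by exact_mod_cast hk0
  have hlt : ‖(θ - 1) / k‖ < 1 := by
    rwa [norm_div, div_lt_one (norm_pos_iff.2 hkne)]
  obtain ⟨e, he⟩ := (PadicInt.norm_lt_one_iff_dvd (⟨(θ - 1) / k, hlt.le⟩ : ℤ_[p])).1 hlt
  refine ⟨e, ?_⟩
  have := congrArg (fun z : ℤ_[p] => (z : ℚ_[p])) he
  simp only [PadicInt.coe_mul, PadicInt.coe_natCast] at this
  rw [div_eq_iff hkne] at this
  linear_combination this

end PadicIsing

open PadicIsing in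
theorem theorem4p7 (p : ℕ) [Fact p.Prime] (hp : 3 ≤ p) (k : ℕ)
    (heven : Even ((p - 1) / Nat.gcd k (p - 1))) (hgcd : 2 ≤ Nat.gcd k (p - 1))
    (N : ℤ) (ρ : ℚ_[p]) (hρ : ρ ∈ PadicIsing.expSet p)
    (hθ : ρ ^ (2 * N) ≠ 1) (hk : ‖ρ ^ (2 * N) - 1‖ < ‖(k : ℚ_[p])‖) :
    {μ : PadicIsing.PadicProbabilityMeasure p (PadicIsing.cylinderAlgebra k) |
      ∃ m : ℕ, 2 ≤ m ∧
        PadicIsing.IsPeriodicQuasiGibbs (PadicIsing.isingInteraction N) ρ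
          (PadicIsing.levelSubsemigroup k m) μ}.Infinite := by
  have hρ0 : ρ ≠ 0 := by
    rintro rfl
    simpa using hρ.1
  have hk0 : k ≠ 0 := by
    rintro rfl
    rw [Nat.cast_zero, norm_zero] at hk
    exact absurd hk (norm_nonneg _).not_gt
  obtain ⟨e, he⟩ := exists_eq_one_add_mul hk0 hk
  have he0 : e ≠ 0 := by
    rintro rfl
    exact hθ (by simpa using he)
  obtain ⟨ya, yb, hya, hyb, hyab⟩ := exists_two_roots_of_neg_one hp heven hgcd
  obtain ⟨φa, Ya, hca, hia, hoa, hYa, hYay, hφa⟩ := exists_branch hp hk0 he0 hya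
  obtain ⟨φb, Yb, hcb, hib, -, hYb, hYby, hφb⟩ := exists_branch hp hk0 he0 hyb
  have h2 : (k * p * e + 2 : ℤ_[p]) ≠ 0 := by
    have : Fact (2 < p) := ⟨by omega⟩
    intro h
    have h1 := congrArg PadicInt.toZMod h
    rw [map_add, map_mul, map_mul, map_natCast PadicInt.toZMod p, ZMod.natCast_self, mul_zero,
      zero_mul, zero_add, map_zero, map_ofNat] at h1
    exact ZMod.neg_one_ne_one (n := p) (by linear_combination -h1)
  have hab : ∀ x y, φa x ≠ φb y := by
    intro x y hxy
    have ha := hφa x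
    have hb := hφb y
    rw [← hxy] at hb
    have hne : φa x + 1 ≠ 0 := fun h0 => h2 (by
      linear_combination (1 + k * p * e - Ya x) * h0 - ha)
    have hY : (φa x + 1) * Ya x = (φa x + 1) * Yb y := by linear_combination hb - ha
    apply hyab
    rw [← hYay x, ← hYby y, mul_left_cancel₀ hne hY]
  obtain ⟨Z, hper, hstep, hne, hinj⟩ :=
    exists_periodic_sequences hca hcb hia hib hab 0 hoa
  set θ : ℚ_[p] := ρ ^ (2 * N) with hθdef
  have hkpe : ((k * p * e : ℤ_[p]) : ℚ_[p]) ≠ 0 := by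
    have : (k * p * e : ℤ_[p]) ≠ 0 :=
      mul_ne_zero (mul_ne_zero (by exact_mod_cast hk0) natCast_p_ne_zero) he0
    exact fun h => this (PadicInt.ext h)
  let t : ℕ → ℕ → ℚ_[p] := fun n j => -1 + ((k * p * e * Z n j : ℤ_[p]) : ℚ_[p])
  have ht : ∀ n j, t n (j + 1) + θ ≠ 0 ∧ ((θ * t n (j + 1) + 1) / (t n (j + 1) + θ)) ^ k = t n j := by
    intro n j
    obtain ⟨Y, hYk, hφ⟩ : ∃ Y : ℤ_[p], Y ^ k = -1 + k * p * e * Z n j ∧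
        Z n (j + 1) * (1 + k * p * e - Y) = Y + 1 := by
      rcases hstep n j with h | h
      · exact ⟨Ya (Z n j), hYa _, by rw [h, hφa]⟩
      · exact ⟨Yb (Z n j), hYb _, by rw [h, hφb]⟩
    have hden : t n (j + 1) + θ = ((k * p * e * (Z n (j + 1) + 1) : ℤ_[p]) : ℚ_[p]) := by
      simp only [t, he]
      push_cast
      ring
    have hnum : θ * t n (j + 1) + 1 = ((k * p * e * (Z n (j + 1) + 1) : ℤ_[p]) : ℚ_[p]) * Y := by
      have := congrArg (fun z : ℤ_[p] => (z : ℚ_[p])) hφ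
      simp only [t, he]
      push_cast at this ⊢
      linear_combination (k * p * e : ℚ_[p]) * this
    have hZ1 : Z n (j + 1) + 1 ≠ 0 := fun h0 => h2 (by
      linear_combination (1 + k * p * e - Y) * h0 - hφ)
    have hd0 : ((k * p * e * (Z n (j + 1) + 1) : ℤ_[p]) : ℚ_[p]) ≠ 0 := by
      rw [PadicInt.coe_mul]
      exact mul_ne_zero hkpe fun h => hZ1 (PadicInt.ext h)
    rw [hden, hnum, mul_div_cancel_left₀ _ hd0, ← PadicInt.coe_pow, hYk]
    refine ⟨hd0, ?_⟩
    simp only [t]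
    push_cast
    ring
  have ht0 : ∀ n, t n 0 ≠ -1 := by
    intro n h
    have h1 : ((k * p * e * Z n 0 : ℤ_[p]) : ℚ_[p]) = 0 := by
      have : -1 + ((k * p * e * Z n 0 : ℤ_[p]) : ℚ_[p]) = -1 := h
      linear_combination this
    rw [PadicInt.coe_mul] at h1
    exact hne n (PadicInt.ext ((mul_eq_zero.1 h1).resolve_left hkpe))
  choose μ hμ using fun n => exists_isQuasiGibbs_levelField (k := k) hρ0 (ht0 n)
    (fun j => (ht n j).1) (fun j => (ht n j).2)
  refine Set.infinite_of_injective_forall_mem (f := μ) ?_ fun n => ?_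
  · intro n m hnm
    have h1 := hμ n
    rw [hnm] at h1
    have h3 := h1.levelField_one_eq hk0 hρ0 (hμ m)
    apply hinj
    have h4 : ((k * p * e * Z n 1 : ℤ_[p]) : ℚ_[p]) = ((k * p * e * Z m 1 : ℤ_[p]) : ℚ_[p]) :=
      add_left_cancel h3
    rw [PadicInt.coe_mul, PadicInt.coe_mul _ (Z m 1)] at h4
    exact PadicInt.ext (mul_left_cancel₀ hkpe h4)
  · refine ⟨n + 2, by omega, levelField k (t n), isPeriodicField_levelField fun j => ?_, hμ n⟩
    simp only [t, hper]
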